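/- Let $p$ be an odd prime and let $m = pt$ with $t \ge 1$. A subset $D$ of a finite group $G$ is a $(v,k,\lambda,\mu)$-partial difference set (PDS) if $|G| = v$, $|D| = k$, every nonidentity element of $D$ can be written as $d_1d_2^{-1}$ with $d_1,d_2\in D$ in exactly $\lambda$ ways, and every nonidentity element of $G\setminus D$ can be so written in exactly $\mu$ ways. Then there is a nonabelian group $\mathcal{G}$ of order $p^{3m}$ that contains a PDS with parameters $$v = p^{3m},\qquad k = (p^m-1)\bigl((p-1)(p^m+1)+1\bigr),$$ $$\lambda = p^m-p+(p^{m+1}-p^m+p)(p-2),\qquad \mu = (p^{m+1}-p^m+p)(p-1).$$ More precisely, put $N = \frac{p^m-1}{p-1}$ and let $G$ be the additive group $\mathrm{GF}(p^m)\times \mathrm{GF}(p^{2m})$. The map $\phi(x,y) = (x^{p^{2t}}, y^{p^{2t}})$ is an automorphism of $G$ of order $p$, and there are primitive elements $\omega$ of $\mathrm{GF}(p^m)$ and $\alpha$ of $\mathrm{GF}(p^{2m})$ such that $$D = \bigcup_{i=0}^{N-1} \bigl(\omega^i\langle\omega^N\rangle\bigr)\times\bigl(\alpha^i\langle\alpha^N\rangle\cup\{0\}\bigr)$$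 is a PDS in $G$ with these parameters and $\phi(D) = D$. Moreover there is a nonabelian subgroup $\mathcal{G}$ of order $p^{3m}$ of $G\rtimes\mathrm{Aut}(G)$ (whose elements are the pairs $(g,\psi)$ with $(g,\psi)(h,\chi) = (g+\psi(h),\psi\chi)$) such that $\psi\in\langle\phi\rangle$ for all $(g,\psi)\in\mathcal{G}$, and $\{(g,\psi)\in\mathcal{G} : g\in D\}$ is a PDS in $\mathcal{G}$ with the same parameters. -/

import Mathlib

/-- `D` is a `(v, k, l, u)`-partial difference set in the finite group `G`: `|G| = v`, `|D| = k`,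
every nonidentity element of `D` is a quotient `d₁ * d₂⁻¹` of elements of `D` in exactly `l` ways,
and every nonidentity element outside `D` in exactly `u` ways. -/
def IsPartialDifferenceSet {G : Type*} [Group G] (D : Set G) (v k l u : ℕ) : Prop :=
  Finite G ∧ Nat.card G = v ∧ D.ncard = k ∧
    (∀ g : G, g ≠ 1 → g ∈ D →
      {d : G × G | d.1 ∈ D ∧ d.2 ∈ D ∧ d.1 * d.2⁻¹ = g}.ncard = l) ∧
    (∀ g : G, g ≠ 1 → g ∉ D →
      {d : G × G | d.1 ∈ D ∧ d.2 ∈ D ∧ d.1 * d.2⁻¹ = g}.ncard = u)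

/-- A partial difference set with the odd Denniston parameters attached to `p` and `m`.
For `2 ≤ p` and `1 ≤ m` none of the natural-number subtractions truncates. -/
def IsOddDennistonPDS {G : Type*} [Group G] (D : Set G) (p m : ℕ) : Prop :=
  IsPartialDifferenceSet D
    (p ^ (3 * m))
    ((p ^ m - 1) * ((p - 1) * (p ^ m + 1) + 1))
    (p ^ m - p + (p ^ (m + 1) - p ^ m + p) * (p - 2))
    ((p ^ (m + 1) - p ^ m + p) * (p - 1))

/-- With `N = (p ^ m - 1) / (p - 1)` (an exact division), the subset
`⋃ i < N, (ω ^ i ⟨ω ^ N⟩) × (α ^ i ⟨α ^ N⟩ ∪ {0})` of `F × E`. -/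
def dennistonSet {F E : Type*} [Field F] [Field E] (p m : ℕ) (ω : Fˣ) (α : Eˣ) : Set (F × E) :=
  ⋃ i ∈ Finset.range ((p ^ m - 1) / (p - 1)),
    {x : F | ∃ h ∈ Subgroup.zpowers (ω ^ ((p ^ m - 1) / (p - 1))), x = ((ω ^ i * h : Fˣ) : F)} ×ˢ
    ({y : E | ∃ h ∈ Subgroup.zpowers (α ^ ((p ^ m - 1) / (p - 1))), y = ((α ^ i * h : Eˣ) : E)}
      ∪ {0})

/-- The automorphism `(x, y) ↦ (x ^ (p ^ n), y ^ (p ^ n))` of the additive group `F × E`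
(written multiplicatively), for finite fields `F` and `E` of characteristic `p`. -/
noncomputable def frobeniusPowerAut (F E : Type*) [Field F] [Field E] [Finite F] [Finite E]
    (p n : ℕ) [Fact p.Prime] [CharP F p] [CharP E p] : MulAut (Multiplicative (F × E)) :=
  AddEquiv.toMultiplicative
    (AddEquiv.prodCongr (iterateFrobeniusEquiv F p n).toAddEquiv
      (iterateFrobeniusEquiv E p n).toAddEquiv)

/-- The holomorph `A ⋊ Aut A` of a group `A`: pairs `⟨a, ψ⟩` with
`⟨a, ψ⟩ * ⟨b, χ⟩ = ⟨a * ψ b, ψ * χ⟩`. -/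
abbrev Holomorph (A : Type*) [Group A] : Type _ := A ⋊[MonoidHom.id (MulAut A)] MulAut A

/-!
Let `K ⊆ F ⊆ E` be finite fields with `[E : F] = 2`. If `ω` is the norm of a primitive element `α`
of `E`, the Denniston set is `{(x, y) | x ≠ 0, N y ∈ K x}`, where `N` is the norm of `E / F`.
Completing the square in the quadratic form `N` evaluates its character sums: a nontrivial
character of `F × E` takes one of the two values `|F| - |K|` and `|F| - |K| - |K| |F|` on it, and
by Ma's criterion this makes it a partial difference set.

This description is visibly invariant under `φ`. Since the trace of `F` to the prime field is
`φ`-invariant as well, the elements `((x, y), φ ^ Tr x)` form a subgroup of the holomorph, which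
acts regularly on `F × E` and therefore inherits the partial difference set. The subgroup is
nonabelian because `φ ≠ 1`.
-/

section CharacterCriterion

open Finset

variable {G : Type*} [AddCommGroup G]

theorem ncard_mul_inv_eq_card_filter_sub [DecidableEq G] (D : Finset G) (a : Multiplicative G) :
    {d : Multiplicative G × Multiplicative G | d.1 ∈ Multiplicative.toAdd ⁻¹' (D : Set G) ∧
      d.2 ∈ Multiplicative.toAdd ⁻¹' (D : Set G) ∧ d.1 * d.2⁻¹ = a}.ncard =
    #{d ∈ D ×ˢ D | d.1 - d.2 = a.toAdd} := by
  rw [← Set.ncard_coe_finset]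
  congr 1
  ext d
  simp only [Set.mem_ofPred_eq, coe_filter, mem_product, and_assoc, ← div_eq_mul_inv]
  rfl

variable [Fintype G]

theorem eq_of_sum_mul_addChar_eq {f g : G → ℂ}
    (h : ∀ χ : AddChar G ℂ, ∑ a, f a * χ a = ∑ a, g a * χ a) : f = g := by
  classical
  have inversion (f : G → ℂ) (b : G) :
      ∑ χ : AddChar G ℂ, (∑ a, f a * χ a) * χ (-b) = f b * Fintype.card G := by
    simp_rw [sum_mul, mul_assoc, ← AddChar.map_add_eq_mul, ← sub_eq_add_neg]
    rw [sum_comm]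
    simp_rw [← mul_sum, AddChar.sum_apply_eq_ite, sub_eq_zero]
    simp
  funext b
  have hG : (Fintype.card G : ℂ) ≠ 0 := Nat.cast_ne_zero.2 Fintype.card_ne_zero
  rw [← mul_left_inj' hG, ← inversion, ← inversion]
  simp_rw [h]

theorem sum_card_filter_sub_eq_mul_addChar [DecidableEq G] (D : Finset G) (χ : AddChar G ℂ) :
    ∑ a, (#{d ∈ D ×ˢ D | d.1 - d.2 = a} : ℂ) * χ a = (∑ d ∈ D, χ d) * ∑ d ∈ D, χ (-d) := by
  rw [sum_mul_sum, ← sum_product', ← sum_fiberwise (D ×ˢ D) fun d => d.1 - d.2]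
  refine sum_congr rfl fun a _ => ?_
  rw [← nsmul_eq_mul, ← sum_const]
  refine sum_congr rfl fun d hd => ?_
  rw [← AddChar.map_add_eq_mul, ← sub_eq_add_neg, (mem_filter.1 hd).2]

theorem card_filter_sub_eq_of_addChar [DecidableEq G] {D : Finset G} {a b c : ℂ}
    (hD : ∀ χ : AddChar G ℂ, (∑ d ∈ D, χ d) * ∑ d ∈ D, χ (-d) =
      a + b * ∑ d ∈ D, χ d + c * ∑ g, χ g) (v : G) :
    (#{d ∈ D ×ˢ D | d.1 - d.2 = v} : ℂ) =
      (if v = 0 then a else 0) + (if v ∈ D then b else 0) + c := by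
  refine congrFun (eq_of_sum_mul_addChar_eq (f := fun v => (#{d ∈ D ×ˢ D | d.1 - d.2 = v} : ℂ))
    (g := fun v => (if v = 0 then a else 0) + (if v ∈ D then b else 0) + c) fun χ => ?_) v
  rw [sum_card_filter_sub_eq_mul_addChar, hD]
  simp only [add_mul, sum_add_distrib, ite_mul, zero_mul, sum_ite_eq', mem_univ, if_true,
    AddChar.map_zero_eq_one, mul_one, sum_ite_mem, univ_inter, mul_sum]

theorem isPartialDifferenceSet_of_sum_addChar {D : Finset G} (hneg : ∀ d ∈ D, -d ∈ D) {θ₁ θ₂ : ℂ}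
    (hθ : ∀ χ : AddChar G ℂ, χ ≠ 0 → ∑ d ∈ D, χ d = θ₁ ∨ ∑ d ∈ D, χ d = θ₂)
    {l u : ℕ} (hl : (l : ℂ) = u + θ₁ + θ₂)
    (hu : (#D - θ₁) * (#D - θ₂) = u * Fintype.card G) :
    IsPartialDifferenceSet (Multiplicative.toAdd ⁻¹' (D : Set G)) (Fintype.card G) #D l u := by
  classical
  have hsymm (χ : AddChar G ℂ) : ∑ d ∈ D, χ (-d) = ∑ d ∈ D, χ d :=
    sum_nbij' (-·) (-·) hneg hneg (by simp) (by simp) (by simp)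
  -- In the group ring, `D² = -θ₁θ₂ + (θ₁ + θ₂) D + u G` (Ma).
  have hquad (χ : AddChar G ℂ) : (∑ d ∈ D, χ d) * ∑ d ∈ D, χ (-d) =
      -(θ₁ * θ₂) + (θ₁ + θ₂) * ∑ d ∈ D, χ d + u * ∑ g, χ g := by
    rw [hsymm, AddChar.sum_eq_ite]
    split_ifs with hχ
    · simp only [hχ, AddChar.zero_apply, sum_const, nsmul_eq_mul, mul_one]
      linear_combination hu
    · rcases hθ χ hχ with h | h <;> rw [h] <;> ring
  have hcount := card_filter_sub_eq_of_addChar hquad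
  refine ⟨inferInstance, (Nat.card_congr Multiplicative.toAdd).trans Nat.card_eq_fintype_card,
    Set.ncard_coe_finset D, fun g hg hgD => ?_, fun g hg hgD => ?_⟩
  all_goals
    rw [Set.mem_preimage, mem_coe] at hgD
    rw [ncard_mul_inv_eq_card_filter_sub, ← Nat.cast_inj (R := ℂ), hcount,
      if_neg (toAdd_eq_zero.not.2 hg)]
    simp only [hgD, if_true, if_false, hl]
    ring

end CharacterCriterion

section QuadraticExtension

variable {F E : Type*} [Field F] [Field E] [Algebra F E]

theorem sum_eq_apply_zero_add_sum_units {K M : Type*} [Field K] [Fintype K] [DecidableEq K]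
    [AddCommMonoid M] (f : K → M) : ∑ b, f b = f 0 + ∑ c : Kˣ, f c := by
  rw [Fintype.sum_eq_add_sum_subtype_ne f 0, ← unitsEquivNeZero.sum_comp]
  rfl

theorem norm_neg_of_finrank_two (h2 : Module.finrank F E = 2) (y : E) :
    Algebra.norm F (-y) = Algebra.norm F y := by
  rw [← neg_one_smul F y, Algebra.smul_def, map_mul, Algebra.norm_algebraMap, h2, neg_one_sq,
    one_mul]

variable [Fintype F]

theorem pow_card_pow_card_of_finrank_two [Finite E] (h2 : Module.finrank F E = 2) (y : E) :
    (y ^ Fintype.card F) ^ Fintype.card F = y := by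
  have := Fintype.ofFinite E
  rw [← pow_mul, ← pow_two, ← h2, ← Module.card_eq_pow_finrank, FiniteField.pow_card]

theorem algebraMap_norm_of_finrank_two [Finite E] (h2 : Module.finrank F E = 2) (y : E) :
    algebraMap F E (Algebra.norm F y) = y * y ^ Fintype.card F := by
  rw [FiniteField.algebraMap_norm_eq_prod_pow, h2, Nat.card_eq_fintype_card,
    Finset.prod_range_succ, Finset.prod_range_one, pow_zero, pow_one, pow_one]

theorem algebraMap_trace_of_finrank_two [Finite E] (h2 : Module.finrank F E = 2) (y : E) :
    algebraMap F E (Algebra.trace F E y) = y + y ^ Fintype.card F := by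
  rw [FiniteField.algebraMap_trace_eq_sum_pow, h2, Nat.card_eq_fintype_card,
    Finset.sum_range_succ, Finset.sum_range_one, pow_zero, pow_one, pow_one]

theorem norm_add_of_finrank_two [Finite E] (h2 : Module.finrank F E = 2) (y u : E) :
    Algebra.norm F (y + u) =
      Algebra.norm F y + Algebra.trace F E (y * u ^ Fintype.card F) + Algebra.norm F u := by
  have hfrob : (y + u) ^ Fintype.card F = y ^ Fintype.card F + u ^ Fintype.card F := by
    simpa only [FiniteField.coe_frobeniusAlgHom] using map_add (FiniteField.frobeniusAlgHom F E) y u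
  apply (algebraMap F E).injective
  simp only [map_add, algebraMap_norm_of_finrank_two h2, algebraMap_trace_of_finrank_two h2,
    mul_pow, pow_card_pow_card_of_finrank_two h2, hfrob]
  ring

theorem sum_addChar_mul_norm [Fintype E] (h2 : Module.finrank F E = 2) {ε : AddChar F ℂ}
    (hε : ε.IsPrimitive) {a : F} (ha : a ≠ 0) :
    ∑ y : E, ε (a * Algebra.norm F y) = -(Fintype.card F : ℂ) := by
  classical
  have hscale (c : Fˣ) : ∑ y : E, ε (c * Algebra.norm F y) = ∑ y : E, ε (a * Algebra.norm F y) := by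
    obtain ⟨s, hs⟩ := FiniteField.unitsMap_norm_surjective F E (Units.mk0 a ha * c⁻¹)
    have hs' : c * Algebra.norm F (s : E) = a := by
      rw [← Units.coe_map, hs, mul_comm, Units.val_mul, Units.inv_mul_cancel_right, Units.val_mk0]
    rw [← Equiv.sum_comp s.mulLeft]
    simp only [Units.mulLeft_apply, map_mul, ← mul_assoc, hs']
  have htotal : ∑ b : F, ∑ y : E, ε (b * Algebra.norm F y) = Fintype.card F := by
    rw [Finset.sum_comm]
    simp only [AddChar.sum_mulShift _ hε, Algebra.norm_eq_zero_iff, Nat.cast_ite, Nat.cast_zero,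
      Finset.sum_ite_eq', Finset.mem_univ, if_true]
  have hE : (Fintype.card E : ℂ) = (Fintype.card F : ℂ) ^ 2 := by
    rw [Module.card_eq_pow_finrank (K := F), h2, Nat.cast_pow]
  have hunits : (Fintype.card Fˣ : ℂ) = Fintype.card F - 1 := by
    rw [Fintype.card_eq_card_units_add_one (α := F), Nat.cast_add_one, add_sub_cancel_right]
  have hF : (Fintype.card F : ℂ) - 1 ≠ 0 :=
    sub_ne_zero.2 (Nat.cast_ne_one.2 Fintype.one_lt_card.ne')
  rw [sum_eq_apply_zero_add_sum_units] at htotal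
  simp only [zero_mul, AddChar.map_zero_eq_one, hscale, Finset.sum_const, Finset.card_univ,
    nsmul_eq_mul, mul_one, hE, hunits] at htotal
  exact mul_left_cancel₀ hF (by linear_combination htotal)

theorem sum_addChar_mul_norm_add_trace [Fintype E] (h2 : Module.finrank F E = 2) {ε : AddChar F ℂ}
    (hε : ε.IsPrimitive) {a : F} (ha : a ≠ 0) (b : E) :
    ∑ y : E, ε (a * Algebra.norm F y + Algebra.trace F E (b * y)) =
      -(Fintype.card F : ℂ) * ε (-(Algebra.norm F b / a)) := by
  have ha' : algebraMap F E a ≠ 0 := (map_ne_zero _).2 ha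
  set u : E := (b / algebraMap F E a) ^ Fintype.card F
  have hNu : a * Algebra.norm F u = Algebra.norm F b / a := by
    have hNb : Algebra.norm F (b / algebraMap F E a) * a ^ 2 = Algebra.norm F b := by
      rw [← h2, ← Algebra.norm_algebraMap, ← map_mul, div_mul_cancel₀ _ ha']
    rw [map_pow, FiniteField.pow_card, ← hNb]
    field_simp
  have hTr (y : E) :
      a * Algebra.trace F E (y * u ^ Fintype.card F) = Algebra.trace F E (b * y) := by
    rw [pow_card_pow_card_of_finrank_two h2, ← smul_eq_mul, ← map_smul, Algebra.smul_def,
      mul_div_assoc', mul_div_cancel₀ _ ha', mul_comm]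
  have hsquare (y : E) : a * Algebra.norm F y + Algebra.trace F E (b * y) =
      a * Algebra.norm F (y + u) + -(Algebra.norm F b / a) := by
    rw [norm_add_of_finrank_two h2, ← hTr, ← hNu]
    ring
  simp only [hsquare, AddChar.map_add_eq_mul, ← Finset.sum_mul]
  rw [← sum_addChar_mul_norm (E := E) h2 hε ha]
  exact congrArg (· * _) (Equiv.sum_comp (Equiv.addRight u) fun y => ε (a * Algebra.norm F y))

end QuadraticExtension

section TraceCharacters

theorem exists_eq_mulShift {R : Type*} [CommRing R] [Finite R] {ψ : AddChar R ℂ}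
    (hψ : ψ.IsPrimitive) (χ : AddChar R ℂ) : ∃ a, χ = ψ.mulShift a := by
  have := Fintype.ofFinite R
  have hbij : Function.Bijective ψ.mulShift := by
    rw [Fintype.bijective_iff_injective_and_card]
    exact ⟨AddChar.to_mulShift_inj_of_isPrimitive hψ, AddChar.card_eq.symm⟩
  exact (hbij.surjective χ).imp fun _ => Eq.symm

theorem exists_isPrimitive_addChar (K : Type*) [Field K] [Finite K] :
    ∃ ψ : AddChar K ℂ, ψ.IsPrimitive := by
  obtain ⟨ψ, hψ⟩ := AddChar.exists_apply_ne_zero.2 (one_ne_zero (α := K))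
  exact ⟨ψ, .of_ne_one fun h => hψ (by rw [h, AddChar.one_apply])⟩

theorem sum_units_addChar_mul {K : Type*} [Field K] [Fintype K] [DecidableEq K] {ψ : AddChar K ℂ}
    (hψ : ψ.IsPrimitive) (t : K) :
    ∑ c : Kˣ, ψ (t * c) = (if t = 0 then (Fintype.card K : ℂ) else 0) - 1 := by
  have h := AddChar.sum_mulShift t hψ
  rw [sum_eq_apply_zero_add_sum_units, zero_mul, AddChar.map_zero_eq_one] at h
  simp only [mul_comm t]
  rw [eq_sub_iff_add_eq', h, Nat.cast_ite, Nat.cast_zero]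

/-- The additive character `ψ ∘ Tr_{F/K}` of `F` induced by a character `ψ` of `K`. -/
noncomputable def traceAddChar {K : Type*} (F : Type*) [Field K] [Field F] [Algebra K F]
    (ψ : AddChar K ℂ) : AddChar F ℂ :=
  ψ.compAddMonoidHom (Algebra.trace K F).toAddMonoidHom

theorem traceAddChar_apply {K F : Type*} [Field K] [Field F] [Algebra K F] (ψ : AddChar K ℂ)
    (x : F) : traceAddChar F ψ x = ψ (Algebra.trace K F x) := rfl

theorem isPrimitive_traceAddChar {K F : Type*} [Field K] [Field F] [Finite F] [Algebra K F]
    {ψ : AddChar K ℂ} (hψ : ψ.IsPrimitive) : (traceAddChar F ψ).IsPrimitive := by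
  have : Finite K := Finite.of_injective _ (algebraMap K F).injective
  refine AddChar.IsPrimitive.of_ne_one fun h => hψ one_ne_zero (DFunLike.ext _ _ fun c => ?_)
  obtain ⟨x, rfl⟩ := Algebra.trace_surjective K F c
  rw [AddChar.mulShift_one, ← traceAddChar_apply, h]
  rfl

theorem exists_addChar_prod_eq {F E : Type*} [Field F] [Field E] [Finite F] [Finite E]
    [Algebra F E] {ε : AddChar F ℂ} (hε : ε.IsPrimitive) (χ : AddChar (F × E) ℂ) :
    ∃ a b, ∀ x y, χ (x, y) = ε (a * x + Algebra.trace F E (b * y)) := by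
  obtain ⟨a, ha⟩ := exists_eq_mulShift hε (χ.compAddMonoidHom (.inl F E))
  obtain ⟨b, hb⟩ := exists_eq_mulShift (isPrimitive_traceAddChar hε)
    (χ.compAddMonoidHom (.inr F E))
  refine ⟨a, b, fun x y => ?_⟩
  have hx : χ (x, 0) = ε (a * x) := DFunLike.congr_fun ha x
  have hy : χ (0, y) = ε (Algebra.trace F E (b * y)) := DFunLike.congr_fun hb y
  rw [AddChar.map_add_eq_mul, ← hx, ← hy, ← AddChar.map_add_eq_mul, Prod.mk_add_mk, add_zero,
    zero_add]

theorem sum_units_addChar_mul_norm_add_trace {K F E : Type*} [Field K] [Field F] [Field E]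
    [Fintype F] [Fintype E] [DecidableEq E] [Algebra K F] [Algebra F E]
    (h2 : Module.finrank F E = 2) {ψ : AddChar K ℂ} (hψ : ψ.IsPrimitive) {a : F} (ha : a ≠ 0)
    (b : E) (c : Kˣ) :
    ∑ y : Eˣ, traceAddChar F ψ (a * c • Algebra.norm F (y : E) + Algebra.trace F E (b * y)) =
      -(Fintype.card F : ℂ) * ψ (Algebra.trace K F (-(Algebra.norm F b / a)) * (c⁻¹ : Kˣ)) - 1 := by
  have hdiv : -(Algebra.norm F b / c • a) = (c⁻¹ : Kˣ) • -(Algebra.norm F b / a) := by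
    rw [smul_neg, Units.smul_def, Units.smul_def, Units.val_inv_eq_inv_val, div_eq_mul_inv,
      smul_inv₀, mul_smul_comm, ← div_eq_mul_inv]
  have h := sum_addChar_mul_norm_add_trace h2 (isPrimitive_traceAddChar hψ)
    (smul_ne_zero c.ne_zero ha) b
  rw [sum_eq_apply_zero_add_sum_units] at h
  simp only [Algebra.norm_zero, mul_zero, map_zero, add_zero, AddChar.map_zero_eq_one,
    ← Units.smul_def, hdiv, smul_mul_assoc] at h
  rw [traceAddChar_apply _ (_ • -_), Units.smul_def, map_smul, smul_eq_mul,
    mul_comm (Units.val _)] at h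
  simp only [mul_smul_comm]
  linear_combination h

end TraceCharacters

section NormLineSet

/-- The pairs `(x, y)` in `F × E` with `x ≠ 0` whose norm `N_{E/F} y` lies on the `K`-line through
`x`. The Denniston set is of this form, with `K` the prime field. -/
def normLineSet (K F E : Type*) [Field K] [Field F] [Field E] [Algebra K F] [Algebra F E] :
    Set (F × E) :=
  {g | g.1 ≠ 0 ∧ ∃ c : K, Algebra.norm F g.2 = c • g.1}

/-- The parametrization of `normLineSet K F E` by the pairs `(x, 0)` with `x ≠ 0` and
`(c • N_{E/F} y, y)` with `c` and `y` nonzero. -/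
noncomputable def normLinePoint (K F E : Type*) [Field K] [Field F] [Field E] [Algebra K F]
    [Algebra F E] : Fˣ ⊕ Kˣ × Eˣ → F × E :=
  Sum.elim (fun x => (x, 0)) fun cy => (cy.1 • Algebra.norm F (cy.2 : E), cy.2)

variable {K F E : Type*} [Field K] [Field F] [Field E] [Algebra K F] [Algebra F E]

theorem mem_normLineSet {g : F × E} :
    g ∈ normLineSet K F E ↔ g.1 ≠ 0 ∧ ∃ c : K, Algebra.norm F g.2 = c • g.1 := Iff.rfl

theorem neg_mem_normLineSet (h2 : Module.finrank F E = 2) {g : F × E}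
    (hg : g ∈ normLineSet K F E) : -g ∈ normLineSet K F E := by
  obtain ⟨hx, c, hc⟩ := hg
  exact ⟨neg_ne_zero.2 hx, -c, by
    rw [Prod.fst_neg, Prod.snd_neg, norm_neg_of_finrank_two h2, hc, neg_smul_neg]⟩

section Parametrization

variable [Finite E]

theorem injective_normLinePoint : Function.Injective (normLinePoint K F E) := by
  refine Function.Injective.sumElim (fun x x' h => Units.ext (congrArg Prod.fst h)) ?_
    fun x cy h => cy.2.ne_zero (congrArg Prod.snd h).symm
  rintro ⟨c, y⟩ ⟨c', y'⟩ h
  obtain ⟨hc, hy⟩ := Prod.mk.inj h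
  obtain rfl : y = y' := Units.ext hy
  have hN : Algebra.norm F (y : E) ≠ 0 := Algebra.norm_ne_zero_iff.2 y.ne_zero
  exact congrArg (·, y) (Units.ext (smul_left_injective K hN hc))

theorem range_normLinePoint : Set.range (normLinePoint K F E) = normLineSet K F E := by
  ext ⟨x, y⟩
  constructor
  · rintro ⟨x | ⟨c, y⟩, h⟩ <;> obtain ⟨rfl, rfl⟩ := Prod.mk.inj h
    · exact ⟨x.ne_zero, 0, by rw [Algebra.norm_zero, zero_smul]⟩
    · exact ⟨smul_ne_zero c.ne_zero (Algebra.norm_ne_zero_iff.2 y.ne_zero), (c⁻¹ : Kˣ),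
        (inv_smul_smul c _).symm⟩
  · rintro ⟨hx, c, hc⟩
    rcases eq_or_ne y 0 with rfl | hy
    · exact ⟨.inl (Units.mk0 x hx), rfl⟩
    · have hc0 : c ≠ 0 := by
        rintro rfl
        exact hy (Algebra.norm_eq_zero_iff.1 (hc.trans (zero_smul K x)))
      refine ⟨.inr ((Units.mk0 c hc0)⁻¹, Units.mk0 y hy), Prod.ext ?_ rfl⟩
      exact (congrArg _ hc).trans (inv_smul_smul (Units.mk0 c hc0) x)

theorem ncard_normLineSet (h2 : Module.finrank F E = 2) :
    (normLineSet K F E).ncard =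
      (Nat.card F - 1) * ((Nat.card K - 1) * (Nat.card F + 1) + 1) := by
  have : Finite F := Finite.of_injective _ (algebraMap F E).injective
  have : Finite K := Finite.of_injective _ (algebraMap K F).injective
  have hE : Nat.card E - 1 = (Nat.card F - 1) * (Nat.card F + 1) := by
    rw [Module.natCard_eq_pow_finrank (K := F), h2, mul_comm, ← Nat.sq_sub_sq, one_pow]
  rw [← range_normLinePoint, ← Set.image_univ,
    Set.ncard_image_of_injective _ injective_normLinePoint, Set.ncard_univ, Nat.card_sum,
    Nat.card_prod, Nat.card_units, Nat.card_units, Nat.card_units, hE]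
  ring

end Parametrization

section Sums

open Finset

variable [Fintype K] [Fintype F] [Fintype (normLineSet K F E)]

theorem sum_normLineSet [Fintype E] [DecidableEq K] [DecidableEq F] [DecidableEq E]
    {M : Type*} [AddCommMonoid M] (f : F × E → M) :
    ∑ g ∈ (normLineSet K F E).toFinset, f g =
      ∑ x : Fˣ, f (x, 0) + ∑ c : Kˣ, ∑ y : Eˣ, f (c • Algebra.norm F (y : E), y) := by
  have h : (normLineSet K F E).toFinset =
      univ.map ⟨normLinePoint K F E, injective_normLinePoint⟩ := by
    ext
    simp [← range_normLinePoint]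
  rw [h, sum_map, Fintype.sum_sum_type, Fintype.sum_prod_type]
  rfl

variable [Finite E]

theorem sum_addChar_trace_normLineSet {ε : AddChar F ℂ} (hε : ε.IsPrimitive) {b : E} (hb : b ≠ 0) :
    ∑ g ∈ (normLineSet K F E).toFinset, ε (Algebra.trace F E (b * g.2)) =
      Fintype.card F - Fintype.card K := by
  classical
  have := Fintype.ofFinite E
  have hy : ∑ y : Eˣ, ε (Algebra.trace F E (b * y)) = -1 := by
    simp only [← traceAddChar_apply, sum_units_addChar_mul (isPrimitive_traceAddChar hε), hb,
      if_false, zero_sub]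
  simp only [sum_normLineSet, mul_zero, map_zero, AddChar.map_zero_eq_one, hy, sum_const,
    card_univ, nsmul_eq_mul, Fintype.card_eq_card_units_add_one (α := F),
    Fintype.card_eq_card_units_add_one (α := K)]
  push_cast
  ring

theorem sum_addChar_mul_add_trace_normLineSet [DecidableEq K] (h2 : Module.finrank F E = 2)
    {ψ : AddChar K ℂ} (hψ : ψ.IsPrimitive) {a : F} (ha : a ≠ 0) (b : E) :
    ∑ g ∈ (normLineSet K F E).toFinset,
        traceAddChar F ψ (a * g.1 + Algebra.trace F E (b * g.2)) =
      Fintype.card F - Fintype.card K -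
        if Algebra.trace K F (-(Algebra.norm F b / a)) = 0 then
          (Fintype.card K : ℂ) * Fintype.card F else 0 := by
  classical
  have := Fintype.ofFinite E
  have hx : ∑ x : Fˣ, traceAddChar F ψ (a * x) = -1 := by
    rw [sum_units_addChar_mul (isPrimitive_traceAddChar hψ), if_neg ha, zero_sub]
  have hc (t : K) : ∑ c : Kˣ, ψ (t * (c⁻¹ : Kˣ)) =
      (if t = 0 then (Fintype.card K : ℂ) else 0) - 1 := by
    rw [← sum_units_addChar_mul hψ, ← Equiv.sum_comp (Equiv.inv Kˣ) fun c : Kˣ => ψ (t * c)]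
    rfl
  simp only [sum_normLineSet, mul_zero, map_zero, add_zero, hx,
    sum_units_addChar_mul_norm_add_trace h2 hψ ha, sum_sub_distrib, ← mul_sum, hc, sum_const,
    card_univ, nsmul_eq_mul, mul_one, Fintype.card_eq_card_units_add_one (α := K)]
  push_cast
  split_ifs <;> ring

theorem sum_addChar_normLineSet (h2 : Module.finrank F E = 2) {χ : AddChar (F × E) ℂ}
    (hχ : χ ≠ 0) :
    ∑ g ∈ (normLineSet K F E).toFinset, χ g = Fintype.card F - Fintype.card K ∨
      ∑ g ∈ (normLineSet K F E).toFinset, χ g =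
        Fintype.card F - Fintype.card K - Fintype.card K * Fintype.card F := by
  classical
  obtain ⟨ψ, hψ⟩ := exists_isPrimitive_addChar K
  obtain ⟨a, b, hab⟩ := exists_addChar_prod_eq (isPrimitive_traceAddChar (F := F) hψ) χ
  rcases eq_or_ne a 0 with rfl | ha
  · have hb : b ≠ 0 := by
      rintro rfl
      exact hχ (DFunLike.ext _ _ fun g => by simp [hab])
    left
    simp only [← sum_addChar_trace_normLineSet (isPrimitive_traceAddChar (F := F) hψ) hb,
      hab, zero_mul, zero_add]
  · have h := sum_addChar_mul_add_trace_normLineSet h2 hψ ha b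
    simp only [← hab] at h
    rw [h]
    split_ifs
    · exact .inr rfl
    · exact .inl (sub_zero _)

end Sums

theorem isPartialDifferenceSet_normLineSet [Finite E] (h2 : Module.finrank F E = 2) :
    IsPartialDifferenceSet (Multiplicative.toAdd ⁻¹' normLineSet K F E) (Nat.card F ^ 3)
      ((Nat.card F - 1) * ((Nat.card K - 1) * (Nat.card F + 1) + 1))
      (Nat.card F - Nat.card K +
        (Nat.card K * Nat.card F - Nat.card F + Nat.card K) * (Nat.card K - 2))
      ((Nat.card K * Nat.card F - Nat.card F + Nat.card K) * (Nat.card K - 1)) := by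
  classical
  have := Fintype.ofFinite E
  have := Fintype.ofInjective _ (algebraMap F E).injective
  have := Fintype.ofInjective _ (algebraMap K F).injective
  have hK : 2 ≤ Nat.card K := Finite.one_lt_card
  have hKF : Nat.card K ≤ Nat.card F := Nat.card_le_card_of_injective _ (algebraMap K F).injective
  have hF : Nat.card F ≤ Nat.card K * Nat.card F := Nat.le_mul_of_pos_left _ Nat.card_pos
  have hcard : Fintype.card (F × E) = Nat.card F ^ 3 := by
    rw [Fintype.card_prod, Module.card_eq_pow_finrank (K := F) (V := E), h2,
      Nat.card_eq_fintype_card]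
    ring
  have hD : (normLineSet K F E).toFinset.card =
      (Nat.card F - 1) * ((Nat.card K - 1) * (Nat.card F + 1) + 1) := by
    rw [← Set.ncard_eq_toFinset_card', ncard_normLineSet h2]
  have h := isPartialDifferenceSet_of_sum_addChar (D := (normLineSet K F E).toFinset)
    (fun d hd => Set.mem_toFinset.2 (neg_mem_normLineSet h2 (Set.mem_toFinset.1 hd)))
    (fun χ hχ => sum_addChar_normLineSet h2 hχ)
    (l := Nat.card F - Nat.card K +
      (Nat.card K * Nat.card F - Nat.card F + Nat.card K) * (Nat.card K - 2))
    (u := (Nat.card K * Nat.card F - Nat.card F + Nat.card K) * (Nat.card K - 1)) ?_ ?_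
  · rwa [hcard, hD, Set.coe_toFinset] at h
  all_goals
    simp only [hD, hcard, ← Nat.card_eq_fintype_card]
    push_cast [Nat.cast_sub hK, Nat.cast_sub hKF, Nat.cast_sub hF,
      Nat.cast_sub (one_le_two.trans hK), Nat.cast_sub (one_le_two.trans (hK.trans hKF))]
    ring

theorem isOddDennistonPDS_normLineSet {p m : ℕ} [Fact p.Prime] [Algebra (ZMod p) F] [Finite E]
    (hF : Nat.card F = p ^ m) (h2 : Module.finrank F E = 2) :
    IsOddDennistonPDS (Multiplicative.toAdd ⁻¹' normLineSet (ZMod p) F E) p m := by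
  have h := isPartialDifferenceSet_normLineSet (K := ZMod p) h2
  rw [Nat.card_zmod, hF, ← pow_mul, mul_comm m, ← pow_succ'] at h
  exact h

end NormLineSet

section Lifting

variable {A H : Type*} [Group A] [Group H]

theorem ncard_mul_inv_eq_of_crossedHom {ε : H ≃ A} {ρ : H → MulAut A}
    (hε : ∀ g h, ε (g * h) = ε g * ρ g (ε h)) {D : Set A} (hD : ∀ g a, ρ g a ∈ D ↔ a ∈ D) (g : H) :
    {d : H × H | d.1 ∈ ε ⁻¹' D ∧ d.2 ∈ ε ⁻¹' D ∧ d.1 * d.2⁻¹ = g}.ncard =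
      {d : A × A | d.1 ∈ D ∧ d.2 ∈ D ∧ d.1 * d.2⁻¹ = ε g}.ncard := by
  let e : H × H ≃ A × A := ε.prodCongr (ε.trans (ρ g).toEquiv)
  have hquot (d : H × H) : d.1 * d.2⁻¹ = g ↔ (e d).1 * (e d).2⁻¹ = ε g := by
    rw [mul_inv_eq_iff_eq_mul, mul_inv_eq_iff_eq_mul, ← ε.apply_eq_iff_eq, hε]
    rfl
  refine Set.ncard_congr' (e.subtypeEquiv fun d => ?_)
  exact and_congr Iff.rfl (and_congr (hD g _).symm (hquot d))

theorem IsPartialDifferenceSet.preimage_crossedHom {D : Set A} {v k l u : ℕ}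
    (h : IsPartialDifferenceSet D v k l u) {ε : H ≃ A} {ρ : H → MulAut A}
    (hε : ∀ g h, ε (g * h) = ε g * ρ g (ε h)) (hD : ∀ g a, ρ g a ∈ D ↔ a ∈ D) :
    IsPartialDifferenceSet (ε ⁻¹' D) v k l u := by
  obtain ⟨_, hv, hk, hl, hu⟩ := h
  have hε_one : ε 1 = 1 := by
    have h1 := hε 1 1
    rwa [mul_one, left_eq_mul, MulEquiv.map_eq_one_iff] at h1
  have hne {g : H} (hg : g ≠ 1) : ε g ≠ 1 := hε_one ▸ ε.injective.ne hg
  refine ⟨.of_equiv A ε.symm, (Nat.card_congr ε).trans hv, ?_, fun g hg hgD => ?_,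
    fun g hg hgD => ?_⟩
  · rw [← hk, ← ε.image_symm_eq_preimage, Set.ncard_image_of_injective _ ε.symm.injective]
  · exact (ncard_mul_inv_eq_of_crossedHom hε hD g).trans (hl _ (hne hg) hgD)
  · exact (ncard_mul_inv_eq_of_crossedHom hε hD g).trans (hu _ (hne hg) hgD)

/-- The graph of a homomorphism `ρ : A → Aut A` with `ρ (ρ a b) = ρ b`, a subgroup of the holomorph
that acts regularly on `A`. -/
def holomorphGraph (ρ : A →* MulAut A) (hρ : ∀ a b, ρ (ρ a b) = ρ b) :
    Subgroup (Holomorph A) where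
  carrier := {g | g.right = ρ g.left}
  one_mem' := (map_one ρ).symm
  mul_mem' {g h} hg hh := by
    rw [Set.mem_ofPred_eq] at hg hh ⊢
    rw [SemidirectProduct.mul_right, SemidirectProduct.mul_left, MonoidHom.id_apply, map_mul, hg,
      hρ, hh]
  inv_mem' {g} hg := by
    rw [Set.mem_ofPred_eq] at hg ⊢
    rw [SemidirectProduct.inv_right, SemidirectProduct.inv_left, MonoidHom.id_apply, hg,
      ← map_inv ρ g.left, hρ, map_inv]

variable {ρ : A →* MulAut A} {hρ : ∀ a b, ρ (ρ a b) = ρ b}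

theorem mem_holomorphGraph {g : Holomorph A} : g ∈ holomorphGraph ρ hρ ↔ g.right = ρ g.left :=
  Iff.rfl

/-- The bijection from the graph of `ρ` to `A` given by first components. -/
def holomorphGraphEquiv (ρ : A →* MulAut A) (hρ : ∀ a b, ρ (ρ a b) = ρ b) :
    holomorphGraph ρ hρ ≃ A where
  toFun g := g.1.left
  invFun a := ⟨⟨a, ρ a⟩, rfl⟩
  left_inv g := Subtype.ext (SemidirectProduct.ext rfl g.2.symm)
  right_inv _ := rfl

theorem holomorphGraphEquiv_mul (g h : holomorphGraph ρ hρ) :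
    holomorphGraphEquiv ρ hρ (g * h) =
      holomorphGraphEquiv ρ hρ g * ρ (holomorphGraphEquiv ρ hρ g) (holomorphGraphEquiv ρ hρ h) :=
  congrArg (g.1.left * · h.1.left) (mem_holomorphGraph.1 g.2)

theorem apply_eq_of_mem_zpowers {β : Type*} {φ ψ : MulAut A} {f : A → β}
    (hφ : ∀ a, f (φ a) = f a) (hψ : ψ ∈ Subgroup.zpowers φ) : ∀ a, f (ψ a) = f a := by
  obtain ⟨n, rfl⟩ := hψ
  refine zpow_induction_left (P := fun ψ : MulAut A => ∀ a, f (ψ a) = f a) (fun _ => rfl)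
    (fun ψ ih a => (hφ (ψ a)).trans (ih a)) (fun ψ ih a => ?_) n
  rw [MulAut.mul_apply, ← hφ, MulAut.apply_inv_self, ih]

theorem IsPartialDifferenceSet.exists_nonabelian_lift {D : Set A} {v k l u : ℕ}
    (h : IsPartialDifferenceSet D v k l u) {φ : MulAut A} (hφD : ∀ a, φ a ∈ D ↔ a ∈ D)
    {ρ : A →* MulAut A} (hρ : ∀ a, ρ a ∈ Subgroup.zpowers φ) (hρφ : ∀ b, ρ (φ b) = ρ b)
    {a b : A} (hab : a * ρ a b ≠ b * ρ b a) :
    ∃ 𝒢 : Subgroup (Holomorph A),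
      (∀ g ∈ 𝒢, g.right ∈ Subgroup.zpowers φ) ∧
      (∃ a ∈ 𝒢, ∃ b ∈ 𝒢, a * b ≠ b * a) ∧
      Nat.card 𝒢 = v ∧
      IsPartialDifferenceSet {g : 𝒢 | (g : Holomorph A).left ∈ D} v k l u := by
  have hinv (c b : A) : ρ (ρ c b) = ρ b := apply_eq_of_mem_zpowers hρφ (hρ c) b
  have hD (c b : A) : ρ c b ∈ D ↔ b ∈ D :=
    iff_of_eq (apply_eq_of_mem_zpowers (f := (· ∈ D)) (fun a => propext (hφD a)) (hρ c) b)
  have hlift := h.preimage_crossedHom (holomorphGraphEquiv_mul (hρ := hinv)) fun g => hD _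
  refine ⟨holomorphGraph ρ hinv, fun g hg => ?_, ?_, hlift.2.1, hlift⟩
  · rw [mem_holomorphGraph.1 hg]
    exact hρ _
  · refine ⟨⟨a, ρ a⟩, rfl, ⟨b, ρ b⟩, rfl, fun hcomm => hab ?_⟩
    exact congrArg SemidirectProduct.left hcomm

end Lifting

section DennistonSet

theorem comap_zpowers_pow {G H : Type*} [Group G] [Group H] (f : G →* H) {g : G}
    (hg : Subgroup.zpowers g = ⊤) {n : ℕ} (hn : n ∣ orderOf (f g)) :
    (Subgroup.zpowers (f g ^ n)).comap f = Subgroup.zpowers (g ^ n) := by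
  rw [← map_pow, ← MonoidHom.map_zpowers, Subgroup.comap_map_eq_self]
  intro x hx
  obtain ⟨j, rfl⟩ : x ∈ Subgroup.zpowers g := hg ▸ Subgroup.mem_top x
  obtain ⟨k, rfl⟩ : (n : ℤ) ∣ j := (Int.natCast_dvd_natCast.2 hn).trans <|
    orderOf_dvd_iff_zpow_eq_one.2 ((map_zpow f g j).symm.trans hx)
  exact ⟨k, by simp only [zpow_mul, zpow_natCast]⟩

theorem exists_lt_inv_pow_mul_mem_zpowers_pow {G : Type*} [Group G] {g : G}
    (hg : Subgroup.zpowers g = ⊤) {n : ℕ} (hn : 0 < n) (x : G) :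
    ∃ i < n, (g ^ i)⁻¹ * x ∈ Subgroup.zpowers (g ^ n) := by
  obtain ⟨j, rfl⟩ : x ∈ Subgroup.zpowers g := hg ▸ Subgroup.mem_top x
  have hn' : (0 : ℤ) < n := Int.natCast_pos.2 hn
  have hi : ((j % n).toNat : ℤ) = j % n := Int.toNat_of_nonneg (Int.emod_nonneg _ hn'.ne')
  refine ⟨(j % n).toNat, by have := Int.emod_lt_of_pos j hn'; omega, j / n, ?_⟩
  simp only
  rw [← zpow_natCast, ← zpow_natCast, ← zpow_mul, hi, eq_inv_mul_iff_mul_eq, ← zpow_add,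
    Int.emod_add_mul_ediv]

theorem orderOf_of_zpowers_eq_top {G : Type*} [Group G] {g : G} (hg : Subgroup.zpowers g = ⊤) :
    orderOf g = Nat.card G := by
  rw [← Nat.card_zpowers, hg, Subgroup.card_top]

section Units

variable {K F : Type*} [Field K] [Field F] [Finite F] [Algebra K F] {ω : Fˣ}

theorem zpowers_map_norm_eq_top (hω : Subgroup.zpowers ω = ⊤) :
    Subgroup.zpowers (Units.map (Algebra.norm K) ω) = ⊤ := by
  rw [← MonoidHom.map_zpowers, hω]
  exact Subgroup.map_top_of_surjective _ (FiniteField.unitsMap_norm_surjective K F)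

theorem zpowers_pow_eq_range_map_algebraMap (hω : Subgroup.zpowers ω = ⊤) :
    Subgroup.zpowers (ω ^ ((Nat.card F - 1) / (Nat.card K - 1))) =
      (Units.map (algebraMap K F : K →* F)).range := by
  have h : ω ^ ((Nat.card F - 1) / (Nat.card K - 1)) =
      Units.map (algebraMap K F : K →* F) (Units.map (Algebra.norm K) ω) :=
    Units.ext (FiniteField.algebraMap_norm_eq_pow ..).symm
  rw [h, ← MonoidHom.map_zpowers, zpowers_map_norm_eq_top hω, ← MonoidHom.range_eq_map]

end Units

theorem exists_mem_val_eq_mul_iff {F : Type*} [Field F] {H : Subgroup Fˣ} {g u : Fˣ} :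
    (∃ h ∈ H, (u : F) = (g * h : Fˣ)) ↔ g⁻¹ * u ∈ H := by
  simp only [Units.val_inj, ← inv_mul_eq_iff_eq_mul, exists_eq_right']

section Membership

variable {F E : Type*} [Field F] [Field E] {q m : ℕ} {ω : Fˣ} {α : Eˣ}

theorem zero_notMem_dennistonSet {y : E} : ((0 : F), y) ∉ dennistonSet q m ω α := by
  simp [dennistonSet]

theorem val_zero_mem_dennistonSet_iff {u : Fˣ} :
    ((u : F), (0 : E)) ∈ dennistonSet q m ω α ↔
      ∃ i < (q ^ m - 1) / (q - 1),
        (ω ^ i)⁻¹ * u ∈ Subgroup.zpowers (ω ^ ((q ^ m - 1) / (q - 1))) := by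
  simp only [dennistonSet, Set.mem_iUnion, Finset.mem_range, Set.mem_prod, Set.mem_union,
    Set.mem_ofPred_eq, Set.mem_singleton_iff, exists_prop, exists_mem_val_eq_mul_iff, or_true,
    and_true]

theorem val_val_mem_dennistonSet_iff {u : Fˣ} {v : Eˣ} :
    ((u : F), (v : E)) ∈ dennistonSet q m ω α ↔
      ∃ i < (q ^ m - 1) / (q - 1),
        (ω ^ i)⁻¹ * u ∈ Subgroup.zpowers (ω ^ ((q ^ m - 1) / (q - 1))) ∧
        (α ^ i)⁻¹ * v ∈ Subgroup.zpowers (α ^ ((q ^ m - 1) / (q - 1))) := by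
  simp only [dennistonSet, Set.mem_iUnion, Finset.mem_range, Set.mem_prod, Set.mem_union,
    Set.mem_ofPred_eq, Set.mem_singleton_iff, exists_prop, exists_mem_val_eq_mul_iff,
    Units.ne_zero, or_false]

end Membership

variable {K F E : Type*} [Field K] [Field F] [Field E] [Algebra K F] [Algebra F E] [Finite E]

theorem val_zero_mem_normLineSet (u : Fˣ) : ((u : F), (0 : E)) ∈ normLineSet K F E :=
  ⟨u.ne_zero, 0, by rw [Algebra.norm_zero, zero_smul]⟩

theorem val_val_mem_normLineSet_iff {u : Fˣ} {v : Eˣ} :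
    ((u : F), (v : E)) ∈ normLineSet K F E ↔
      u⁻¹ * Units.map (Algebra.norm F) v ∈ (Units.map (algebraMap K F : K →* F)).range := by
  have key (c : Kˣ) : Units.map (algebraMap K F : K →* F) c = u⁻¹ * Units.map (Algebra.norm F) v ↔
      Algebra.norm F (v : E) = (c : K) • (u : F) := by
    rw [eq_inv_mul_iff_mul_eq, mul_comm, eq_comm, Units.ext_iff, Algebra.smul_def]
    rfl
  constructor
  · rintro ⟨-, c, hc⟩
    have hc0 : c ≠ 0 := by
      rintro rfl
      exact Algebra.norm_ne_zero_iff.2 v.ne_zero (hc.trans (zero_smul K _))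
    exact ⟨Units.mk0 c hc0, (key _).2 hc⟩
  · rintro ⟨c, hc⟩
    exact ⟨u.ne_zero, c, (key c).1 hc⟩

theorem dennistonSet_map_norm_eq_normLineSet {m : ℕ} (hF : Nat.card F = Nat.card K ^ m) {α : Eˣ}
    (hα : Subgroup.zpowers α = ⊤) :
    dennistonSet (Nat.card K) m (Units.map (Algebra.norm F) α) α = normLineSet K F E := by
  have : Finite F := Finite.of_injective _ (algebraMap F E).injective
  have hω := zpowers_map_norm_eq_top (K := F) hα
  have hrange := zpowers_pow_eq_range_map_algebraMap (K := K) hω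
  have hdvd := Nat.div_dvd_of_dvd (Nat.sub_one_dvd_pow_sub_one (Nat.card K) m)
  rw [← hF] at hdvd
  have hcomap := comap_zpowers_pow (Units.map (Algebra.norm F : E →* F)) hα
    (n := (Nat.card F - 1) / (Nat.card K - 1))
    (by rwa [orderOf_of_zpowers_eq_top hω, Nat.card_units])
  have hrep := exists_lt_inv_pow_mul_mem_zpowers_pow hω
    (Nat.pos_of_dvd_of_pos hdvd (Nat.sub_pos_of_lt Finite.one_lt_card))
  ext ⟨x, y⟩
  rcases eq_or_ne x 0 with rfl | hx
  · exact iff_of_false zero_notMem_dennistonSet fun h => h.1 rfl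
  lift x to Fˣ using hx.isUnit
  rcases eq_or_ne y 0 with rfl | hy
  · refine iff_of_true (val_zero_mem_dennistonSet_iff.2 ?_) (val_zero_mem_normLineSet x)
    rw [← hF]
    exact hrep x
  lift y to Eˣ using hy.isUnit
  rw [val_val_mem_dennistonSet_iff, val_val_mem_normLineSet_iff, ← hF, ← hrange, ← hcomap]
  simp only [Subgroup.mem_comap, map_mul, map_inv, map_pow]
  constructor
  · rintro ⟨i, -, hxi, hyi⟩
    have := mul_mem (inv_mem hxi) hyi
    rwa [mul_inv_rev, inv_inv, mul_assoc, mul_inv_cancel_left] at this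
  · intro h
    obtain ⟨i, hi, hxi⟩ := hrep x
    refine ⟨i, hi, hxi, ?_⟩
    have := mul_mem hxi h
    rwa [mul_assoc, mul_inv_cancel_left] at this

end DennistonSet

section Frobenius

theorem forall_pow_card_pow_eq_iff_finrank_dvd {K L : Type*} [Field K] [Field L] [Finite L]
    [Algebra K L] {n : ℕ} : (∀ x : L, x ^ Nat.card K ^ n = x) ↔ Module.finrank K L ∣ n := by
  have := Finite.of_injective _ (algebraMap K L).injective
  have := Fintype.ofFinite K
  rw [← FiniteField.orderOf_frobeniusAlgHom, orderOf_dvd_iff_pow_eq_one, AlgHom.ext_iff]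
  simp only [AlgHom.coe_pow, FiniteField.coe_frobeniusAlgHom, pow_iterate, AlgHom.one_apply,
    Nat.card_eq_fintype_card]

theorem finrank_eq_of_card_eq_pow {K L : Type*} [Field K] [Field L] [Finite L] [Algebra K L]
    {q a b : ℕ} (hK : Nat.card K = q ^ a) (hL : Nat.card L = q ^ (b * a)) :
    Module.finrank K L = b := by
  have := Finite.of_injective _ (algebraMap K L).injective
  refine Nat.pow_right_injective (Finite.one_lt_card (α := K)) ?_
  simp only
  rw [← Module.natCard_eq_pow_finrank, hL, hK, ← pow_mul, mul_comm]

theorem exists_algebra_finrank_eq_two {p m : ℕ} [Fact p.Prime] {F E : Type*} [Field F] [Field E]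
    [Finite E] [CharP F p] [CharP E p] (hF : Nat.card F = p ^ m)
    (hE : Nat.card E = p ^ (2 * m)) : ∃ _ : Algebra F E, Module.finrank F E = 2 := by
  have : Finite F := Nat.finite_of_card_ne_zero (hF ▸ pow_ne_zero _ (Fact.out : p.Prime).ne_zero)
  let := ZMod.algebra F p
  let := ZMod.algebra E p
  have hK : Nat.card (ZMod p) = p ^ 1 := by rw [Nat.card_zmod, pow_one]
  have hdvd : Module.finrank (ZMod p) F ∣ Module.finrank (ZMod p) E := by
    rw [finrank_eq_of_card_eq_pow hK (by rwa [mul_one]),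
      finrank_eq_of_card_eq_pow hK (by rwa [mul_one])]
    exact dvd_mul_left _ _
  obtain ⟨f⟩ := FiniteField.nonempty_algHom_of_finrank_dvd hdvd
  algebraize [f.toRingHom]
  exact ⟨inferInstance, finrank_eq_of_card_eq_pow hF hE⟩

theorem forall_pow_prime_pow_eq_iff_dvd {p k n : ℕ} [Fact p.Prime] {F : Type*} [Field F]
    [Finite F] [CharP F p] (hF : Nat.card F = p ^ k) : (∀ x : F, x ^ p ^ n = x) ↔ k ∣ n := by
  let := ZMod.algebra F p
  have hK := Nat.card_zmod p
  have hk : Module.finrank (ZMod p) F = k :=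
    finrank_eq_of_card_eq_pow (hK.trans (pow_one p).symm) (by rwa [mul_one])
  rw [← hk, ← forall_pow_card_pow_eq_iff_finrank_dvd, hK]

variable {p : ℕ} [Fact p.Prime] {F E : Type*} [Field F] [Field E]

section TraceTwist

variable [Algebra (ZMod p) F]

/-- The homomorphism `(x, y) ↦ φ ^ Tr x` from `F × E` to its automorphism group, for an
automorphism `φ` with `φ ^ p = 1`. The trace to the prime field is lifted to a natural number
below `p`. -/
noncomputable def powTraceHom (φ : MulAut (Multiplicative (F × E))) (hφ : φ ^ p = 1) :
    Multiplicative (F × E) →* MulAut (Multiplicative (F × E)) where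
  toFun g := φ ^ (Algebra.trace (ZMod p) F g.toAdd.1).val
  map_one' := by
    rw [toAdd_one, Prod.fst_zero, map_zero, ZMod.val_zero, pow_zero]
  map_mul' g h := by
    rw [toAdd_mul, Prod.fst_add, map_add, ZMod.val_add, ← pow_eq_pow_mod _ hφ, pow_add]

theorem powTraceHom_apply {φ : MulAut (Multiplicative (F × E))} {hφ : φ ^ p = 1}
    {g : Multiplicative (F × E)} :
    powTraceHom φ hφ g = φ ^ (Algebra.trace (ZMod p) F g.toAdd.1).val := rfl

theorem trace_pow_prime_pow [Finite F] [CharP F p] (n : ℕ) (x : F) :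
    Algebra.trace (ZMod p) F (x ^ p ^ n) = Algebra.trace (ZMod p) F x :=
  Algebra.trace_eq_of_algEquiv
    (AlgEquiv.ofRingEquiv (f := iterateFrobeniusEquiv F p n) fun c => by
      rw [iterateFrobeniusEquiv_def, ← map_pow, ZMod.pow_card_pow]) x

end TraceTwist

variable [Finite F] [Finite E] [CharP F p] [CharP E p]

theorem frobeniusPowerAut_apply (n : ℕ) (g : Multiplicative (F × E)) :
    frobeniusPowerAut F E p n g =
      Multiplicative.ofAdd (g.toAdd.1 ^ p ^ n, g.toAdd.2 ^ p ^ n) := rfl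

theorem frobeniusPowerAut_pow (n k : ℕ) :
    frobeniusPowerAut F E p n ^ k = frobeniusPowerAut F E p (n * k) := by
  induction k with
  | zero =>
    refine MulEquiv.ext fun g => ?_
    simp only [frobeniusPowerAut_apply, pow_zero, mul_zero, pow_one, MulAut.one_apply]
    rfl
  | succ k ih =>
    refine MulEquiv.ext fun g => ?_
    rw [pow_succ, ih, MulAut.mul_apply]
    simp only [frobeniusPowerAut_apply, toAdd_ofAdd, ← pow_mul, ← pow_add]
    rw [mul_add_one, add_comm n]

variable [Algebra F E]

theorem frobeniusPowerAut_eq_one_iff {n : ℕ} :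
    frobeniusPowerAut F E p n = 1 ↔ ∀ y : E, y ^ p ^ n = y := by
  refine ⟨fun h y => congrArg (fun g => g.toAdd.2)
    (DFunLike.congr_fun h (Multiplicative.ofAdd ((0 : F), y))), fun h => ?_⟩
  have hF (x : F) : x ^ p ^ n = x :=
    (algebraMap F E).injective (by rw [map_pow, h])
  refine MulEquiv.ext fun g => ?_
  rw [frobeniusPowerAut_apply, hF, h]
  rfl

theorem orderOf_frobeniusPowerAut {n : ℕ} (hn : n ≠ 0) (hE : Nat.card E = p ^ (n * p)) :
    orderOf (frobeniusPowerAut F E p n) = p := by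
  refine orderOf_eq_prime ?_ ?_
  · rw [frobeniusPowerAut_pow, frobeniusPowerAut_eq_one_iff, forall_pow_prime_pow_eq_iff_dvd hE]
  · rw [Ne, frobeniusPowerAut_eq_one_iff, forall_pow_prime_pow_eq_iff_dvd hE]
    exact Nat.not_dvd_of_pos_of_lt hn.bot_lt
      (lt_mul_of_one_lt_right hn.bot_lt (Fact.out : p.Prime).one_lt)

variable [Algebra (ZMod p) F]

theorem frobeniusPowerAut_mem_normLineSet_iff (n : ℕ) (g : Multiplicative (F × E)) :
    frobeniusPowerAut F E p n g ∈ Multiplicative.toAdd ⁻¹' normLineSet (ZMod p) F E ↔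
      g ∈ Multiplicative.toAdd ⁻¹' normLineSet (ZMod p) F E := by
  simp only [Set.mem_preimage, mem_normLineSet, frobeniusPowerAut_apply, toAdd_ofAdd, map_pow]
  refine and_congr (pow_ne_zero_iff (pow_ne_zero _ (Fact.out : p.Prime).ne_zero))
    (exists_congr fun c => ?_)
  have h := (iterateFrobeniusEquiv F p n).injective.eq_iff
    (a := Algebra.norm F g.toAdd.2) (b := c • g.toAdd.1)
  rwa [iterateFrobeniusEquiv_def, iterateFrobeniusEquiv_def, smul_pow, ZMod.pow_card_pow] at h

theorem image_frobeniusPowerAut_normLineSet (n : ℕ) :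
    frobeniusPowerAut F E p n '' (Multiplicative.toAdd ⁻¹' normLineSet (ZMod p) F E) =
      Multiplicative.toAdd ⁻¹' normLineSet (ZMod p) F E := by
  nth_rw 1 [← Set.ext (frobeniusPowerAut_mem_normLineSet_iff n)]
  exact Set.image_preimage_eq _ (frobeniusPowerAut F E p n).surjective

theorem exists_nonabelian_isOddDennistonPDS {m n : ℕ} (hF : Nat.card F = p ^ m)
    (h2 : Module.finrank F E = 2) (hφ : orderOf (frobeniusPowerAut F E p n) = p) :
    ∃ 𝒢 : Subgroup (Holomorph (Multiplicative (F × E))),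
      (∀ g ∈ 𝒢, g.right ∈ Subgroup.zpowers (frobeniusPowerAut F E p n)) ∧
      (∃ a ∈ 𝒢, ∃ b ∈ 𝒢, a * b ≠ b * a) ∧
      Nat.card 𝒢 = p ^ (3 * m) ∧
      IsOddDennistonPDS {g : 𝒢 | (g : Holomorph (Multiplicative (F × E))).left ∈
        Multiplicative.toAdd ⁻¹' normLineSet (ZMod p) F E} p m := by
  have hp : Fact (1 < p) := ⟨(Fact.out : p.Prime).one_lt⟩
  have hφ1 : frobeniusPowerAut F E p n ≠ 1 := fun h => by
    rw [h, orderOf_one] at hφ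
    exact hp.out.ne hφ
  obtain ⟨y, hy⟩ := not_forall.1 (mt frobeniusPowerAut_eq_one_iff.2 hφ1)
  obtain ⟨x, hx⟩ := Algebra.trace_surjective (ZMod p) F 1
  have hφp : frobeniusPowerAut F E p n ^ p = 1 := orderOf_dvd_iff_pow_eq_one.1 hφ.dvd
  refine (isOddDennistonPDS_normLineSet hF h2).exists_nonabelian_lift
    (frobeniusPowerAut_mem_normLineSet_iff n) (ρ := powTraceHom _ hφp)
    (fun _ => Subgroup.npow_mem_zpowers _ _) (fun b => ?_)
    (a := Multiplicative.ofAdd (x, 0)) (b := Multiplicative.ofAdd (0, y)) fun hab => hy ?_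
  · rw [powTraceHom_apply, powTraceHom_apply, frobeniusPowerAut_apply, toAdd_ofAdd,
      trace_pow_prime_pow]
  · rw [powTraceHom_apply, powTraceHom_apply, toAdd_ofAdd, toAdd_ofAdd, hx, map_zero, ZMod.val_one,
      ZMod.val_zero, pow_one, pow_zero, frobeniusPowerAut_apply, MulAut.one_apply] at hab
    simpa using congrArg (fun g => g.toAdd.2) hab

end Frobenius

theorem theorem6p7_general {p t m : ℕ} [Fact p.Prime] {F E : Type*} [Field F] [Field E] [Finite F]
    [Finite E] [CharP F p] [CharP E p] (hm : m = p * t) (hF : Nat.card F = p ^ m)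
    (hE : Nat.card E = p ^ (2 * m)) :
    ∃ (ω : Fˣ) (α : Eˣ) (φ : MulAut (Multiplicative (F × E))) (D : Set (Multiplicative (F × E))),
      Subgroup.zpowers ω = ⊤ ∧ Subgroup.zpowers α = ⊤ ∧
      D = Multiplicative.toAdd ⁻¹' dennistonSet p m ω α ∧
      IsOddDennistonPDS D p m ∧
      φ = frobeniusPowerAut F E p (2 * t) ∧
      orderOf φ = p ∧ φ '' D = D ∧
      ∃ 𝒢 : Subgroup (Holomorph (Multiplicative (F × E))),
        (∀ g ∈ 𝒢, g.right ∈ Subgroup.zpowers φ) ∧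
        (∃ a ∈ 𝒢, ∃ b ∈ 𝒢, a * b ≠ b * a) ∧
        Nat.card 𝒢 = p ^ (3 * m) ∧
        IsOddDennistonPDS
          {g : 𝒢 | (g : Holomorph (Multiplicative (F × E))).left ∈ D} p m := by
  obtain ⟨_, h2⟩ := exists_algebra_finrank_eq_two hF hE
  let := ZMod.algebra F p
  obtain ⟨α, hα⟩ := isCyclic_iff_exists_zpowers_eq_top.1 (inferInstance : IsCyclic Eˣ)
  have hD := dennistonSet_map_norm_eq_normLineSet (K := ZMod p) (F := F) (m := m)
    (by rw [hF, Nat.card_zmod]) hα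
  rw [Nat.card_zmod] at hD
  have ht : 2 * t ≠ 0 := by
    intro h
    obtain rfl : t = 0 := by omega
    exact (Finite.one_lt_card (α := F)).ne' (by rw [hF, hm, mul_zero, pow_zero])
  have hφ : orderOf (frobeniusPowerAut F E p (2 * t)) = p :=
    orderOf_frobeniusPowerAut ht (by rw [hE, hm, mul_assoc, mul_comm p])
  exact ⟨Units.map (Algebra.norm F) α, α, _, _, zpowers_map_norm_eq_top hα, hα,
    congrArg (Multiplicative.toAdd ⁻¹' ·) hD.symm, isOddDennistonPDS_normLineSet hF h2, rfl, hφ,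
    image_frobeniusPowerAut_normLineSet _, exists_nonabelian_isOddDennistonPDS hF h2 hφ⟩

theorem theorem6p7 (p t m : ℕ) [Fact p.Prime] (hp : Odd p) (ht : 0 < t) (hm : m = p * t) :
    ∃ (ω : (GaloisField p m)ˣ) (α : (GaloisField p (2 * m))ˣ)
      (φ : MulAut (Multiplicative (GaloisField p m × GaloisField p (2 * m))))
      (D : Set (Multiplicative (GaloisField p m × GaloisField p (2 * m)))),
      -- `ω` and `α` are primitive elements
      Subgroup.zpowers ω = ⊤ ∧ Subgroup.zpowers α = ⊤ ∧
      -- the partial difference set in the elementary abelian group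
      D = Multiplicative.toAdd ⁻¹' dennistonSet p m ω α ∧
      IsOddDennistonPDS D p m ∧
      -- the automorphism of order `p` preserving it
      φ = frobeniusPowerAut (GaloisField p m) (GaloisField p (2 * m)) p (2 * t) ∧
      orderOf φ = p ∧ φ '' D = D ∧
      -- the nonabelian group, inside the semidirect product with `⟨φ⟩`
      ∃ 𝒢 : Subgroup (Holomorph (Multiplicative (GaloisField p m × GaloisField p (2 * m)))),
        (∀ g ∈ 𝒢, g.right ∈ Subgroup.zpowers φ) ∧
        (∃ a ∈ 𝒢, ∃ b ∈ 𝒢, a * b ≠ b * a) ∧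
        Nat.card 𝒢 = p ^ (3 * m) ∧
        IsOddDennistonPDS
          {g : 𝒢 | (g : Holomorph (Multiplicative
            (GaloisField p m × GaloisField p (2 * m)))).left ∈ D} p m := by
  have hm0 : m ≠ 0 := hm ▸ mul_ne_zero (Fact.out : p.Prime).ne_zero ht.ne'
  exact theorem6p7_general hm (GaloisField.card p m hm0)
    (GaloisField.card p _ (mul_ne_zero two_ne_zero hm0))
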